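/- Let $\Bbbk$ be an algebraically closed field and let $A$ be a finite dimensional unital $\Bbbk$-algebra that is basic (all simple $A$-modules are one-dimensional). Let $A\text{-}\mathrm{mod}$ be the category of finite dimensional left $A$-modules, let $L_1,\dots,L_n$ be a complete list of pairwise nonisomorphic simple $A$-modules, and let $P_i\twoheadrightarrow L_i$ be projective covers. All functors are additive and $\Bbbk$-linear; an endofunctor is selfadjoint if it is adjoint to itself. For a polynomial $g(x)=\sum_m g_m x^m$ with nonnegative integer coefficients and an endofunctor $\mathrm{G}$, put $g(\mathrm{G})=\bigoplus_m (\mathrm{G}^m)^{\oplus g_m}$, where $\mathrm{G}^0$ is the identity functor. Let $S\subsetneq\{1,\dots,n\}$ and $S'=\{1,\dots,n\}\setminus S$. Let $\mathcal{N}_S$ be the full subcategory of all $N\in A\text{-}\mathrm{mod}$ such that $[N:L_i]\neq 0$ implies $i\in S$. Put $P_{S'}=\bigoplus_{i\in S'}P_i$, let $B_{S'}=\mathrm{End}_A(P_{S'})^{\mathrm{op}}$, let $I_S\subseteq A$ be the trace of $P_{S'}$ in ${}_AA$ (the sum of the images of all homomorphisms $P_{S'}\to A$; it is a two-sided ideal),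 and let $D_S=A/I_S$. Let $\mathrm{add}(P_{S'})$ be the class of all modules isomorphic to finite direct sums of direct summands of $P_{S'}$, and let $\mathcal{X}_{P_{S'}}$ be the full subcategory of all modules $Y$ admitting an exact sequence $X_1\to X_0\to Y\to 0$ with $X_0,X_1\in\mathrm{add}(P_{S'})$. Let $\mathrm{F}$ be a selfadjoint endofunctor of $A\text{-}\mathrm{mod}$ (so that $\mathrm{F}$ is exact and induces an endomorphism $[\mathrm{F}]$ of the Grothendieck group $[A]$ of $A\text{-}\mathrm{mod}$), and assume that the linear span of the classes $[L_i]$, $i\in S$, in $[A]$ is invariant under $[\mathrm{F}]$. Then: (i) $\mathrm{F}$ preserves $\mathcal{N}_S$. Restriction of scalars along $A\to D_S$ is an equivalence $\Psi\colon D_S\text{-}\mathrm{mod}\to\mathcal{N}_S$, and $\hat{\mathrm{F}}:=\Psi^{-1}\circ\mathrm{F}|_{\mathcal{N}_S}\circ\Psi$ is a selfadjoint (additive, $\Bbbk$-linear) endofunctor of $D_S\text{-}\mathrm{mod}$. (ii) $\mathrm{F}$ preserves $\mathcal{X}_{P_{S'}}$. The functor $\Phi=\mathrm{Hom}_A(P_{S'},-)\colon\mathcal{X}_{P_{S'}}\to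 B_{S'}\text{-}\mathrm{mod}$ is an equivalence, and $\overline{\mathrm{F}}:=\Phi\circ\mathrm{F}|_{\mathcal{X}_{P_{S'}}}\circ\Phi^{-1}$ is a selfadjoint (additive, $\Bbbk$-linear) endofunctor of $B_{S'}\text{-}\mathrm{mod}$. (iii) If $g(x),h(x)$ are polynomials with nonnegative integer coefficients and $g(\mathrm{F})\cong h(\mathrm{F})$, then $g(\hat{\mathrm{F}})\cong h(\hat{\mathrm{F}})$ and $g(\overline{\mathrm{F}})\cong h(\overline{\mathrm{F}})$. -/

import Mathlib

open CategoryTheory CategoryTheory.Limits Polynomial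

universe w u v v₁ v₂ u₁ u₂

namespace SelfadjointFunctors

noncomputable section

/-! ### Finite direct sums of finitely generated modules -/

theorem isClosedUnderFiniteProducts_isFG (R : Type u) [Ring R] :
    (ModuleCat.isFG.{u} R).IsClosedUnderFiniteProducts where
  isClosedUnderLimitsOfShape J _ := by
    have : (ModuleCat.isFG.{u} R).IsClosedUnderIsomorphisms :=
      ⟨fun {M N} e (_ : Module.Finite R M) => Module.Finite.equiv e.toLinearEquiv⟩
    refine ObjectProperty.IsClosedUnderLimitsOfShape.mk' ?_
    rintro _ ⟨G, hG⟩
    have : ∀ j : J, Module.Finite R (G.obj ⟨j⟩) := fun j => hG ⟨j⟩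
    have h : ModuleCat.isFG R (∏ᶜ fun j : J => G.obj ⟨j⟩) :=
      (inferInstance : Module.Finite R (∏ᶜ fun j : J => G.obj ⟨j⟩ : ModuleCat.{u} R))
    exact (ModuleCat.isFG R).prop_of_iso (HasLimit.isoOfNatIso
      (Discrete.natIso fun j => Iso.refl _ : Discrete.functor (fun j : J => G.obj ⟨j⟩) ≅ G)) h

instance hasFiniteBiproducts_fgModuleCat (R : Type u) [Ring R] :
    HasFiniteBiproducts (FGModuleCat.{u} R) := by
  have := isClosedUnderFiniteProducts_isFG R
  have h : HasFiniteProducts (FGModuleCat.{u} R) := ⟨fun n => inferInstance⟩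
  exact HasFiniteBiproducts.of_hasFiniteProducts

/-! ### Basic algebras, simple modules, projective covers, multiplicities -/

/-- `A` is basic over `k`: every simple `A`-module is one-dimensional over `k`. -/
def IsBasicAlgebra (k : Type w) (A : Type u) [Field k] [Ring A] [Algebra k A] : Prop :=
  ∀ (M : Type u) [AddCommGroup M] [Module k M] [Module A M] [IsScalarTower k A M]
    [IsSimpleModule A M], Module.finrank k M = 1

section Modules

variable {A : Type u} [Ring A]

/-- `L` is a complete list of pairwise nonisomorphic simple modules. -/
structure IsCompleteSimpleList {n : ℕ} (L : Fin n → FGModuleCat.{u} A) : Prop where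
  simple : ∀ i, IsSimpleModule A (L i)
  pairwise : ∀ i j, Nonempty (L i ≅ L j) → i = j
  complete : ∀ M : FGModuleCat.{u} A, IsSimpleModule A M → ∃ i, Nonempty (M ≅ L i)

/-- `π : P ⟶ L` is a projective cover: `P` is projective and `π` is a surjection with
superfluous kernel. -/
structure IsProjectiveCover {P L : FGModuleCat.{u} A} (π : P ⟶ L) : Prop where
  projective : Module.Projective A P
  surjective : Function.Surjective π.hom.hom
  superfluous : ∀ N : Submodule A P, N ⊔ LinearMap.ker π.hom.hom = ⊤ → N = ⊤

/-- The subquotient `s (j + 1) / s j` of a chain of submodules. -/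
abbrev Subfactor {M : Type u} [AddCommGroup M] [Module A M]
    (s : CompositionSeries (Submodule A M)) (j : Fin s.length) : Type u :=
  ↥(s j.succ) ⧸ (s j.castSucc).submoduleOf (s j.succ)

/-- The composition multiplicity `[M : L]`, i.e. the number of subquotients isomorphic to `L`
in a composition series of `M` (all composition series give the same number). -/
def compositionMultiplicity (M L : FGModuleCat.{u} A) : ℕ :=
  sInf {m | ∃ s : CompositionSeries (Submodule A M), s.head = ⊥ ∧ s.last = ⊤ ∧
    m = Nat.card {j : Fin s.length // Nonempty (Subfactor s j ≃ₗ[A] L)}}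

/-- The subcategory `𝒩_S`: all `M` such that `[M : L i] ≠ 0` implies `i ∈ S`. -/
def serre {n : ℕ} (L : Fin n → FGModuleCat.{u} A) (S : Set (Fin n)) :
    ObjectProperty (FGModuleCat.{u} A) :=
  fun M => ∀ i, compositionMultiplicity M (L i) ≠ 0 → i ∈ S

/-- `P_T`, the direct sum of the `P i` with `i ∈ T`. -/
def coverSum {n : ℕ} (P : Fin n → FGModuleCat.{u} A) (T : Set (Fin n)) : FGModuleCat.{u} A :=
  ⨁ fun i : T => P i

/-- The trace of a module `X` in the regular module: the sum of the images of all
homomorphisms `X → A`. -/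
def traceIdeal (X : FGModuleCat.{u} A) : Ideal A :=
  ⨆ f : X →ₗ[A] A, LinearMap.range f

instance isTwoSided_traceIdeal (X : FGModuleCat.{u} A) : (traceIdeal X).IsTwoSided where
  mul_mem_of_left {a} b ha := by
    have h : traceIdeal X ≤ Submodule.comap (LinearMap.toSpanSingleton A A b) (traceIdeal X) := by
      refine iSup_le fun f => ?_
      rintro _ ⟨x, rfl⟩
      exact Submodule.mem_iSup_of_mem ((LinearMap.toSpanSingleton A A b).comp f) ⟨x, rfl⟩
    exact h ha

/-- The quotient `D_S` of `A` by the trace `I_S` of `P_{S'}`, where `S'` is the complement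
of `S`. -/
abbrev quotientAlgebra {n : ℕ} (P : Fin n → FGModuleCat.{u} A) (S : Set (Fin n)) : Type u :=
  A ⧸ traceIdeal (coverSum P Sᶜ)

/-- The algebra `B_T = End_A(P_T)ᵒᵖ`. -/
abbrev centralizerAlgebra {n : ℕ} (P : Fin n → FGModuleCat.{u} A) (T : Set (Fin n)) : Type u :=
  (End (coverSum P T))ᵐᵒᵖ

/-- Restriction of scalars along `A → A / I` for finitely generated modules. -/
def quotientRestrict (I : Ideal A) [I.IsTwoSided] :
    FGModuleCat.{u} (A ⧸ I) ⥤ FGModuleCat.{u} A :=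
  (ModuleCat.isFG A).lift
    ((ModuleCat.isFG (A ⧸ I)).ι ⋙ ModuleCat.restrictScalars (Ideal.Quotient.mk I))
    (fun M => by
      let r : Module A M := Module.compHom M (Ideal.Quotient.mk I)
      obtain ⟨t, ht⟩ := (inferInstance : Module.Finite (A ⧸ I) M).fg_top
      refine (⟨⟨t, ?_⟩⟩ : @Module.Finite A M _ _ r)
      refine (Submodule.eq_top_iff' (R := A) (M := M)).2 fun x => ?_
      have hx : x ∈ Submodule.span (A ⧸ I) (t : Set M) := ht ▸ Submodule.mem_top
      induction hx using Submodule.span_induction with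
      | mem x hx => exact Submodule.subset_span hx
      | zero => exact Submodule.zero_mem _
      | add x y _ _ hx hy => exact Submodule.add_mem _ hx hy
      | smul a x _ hx =>
        obtain ⟨a, rfl⟩ := Ideal.Quotient.mk_surjective a
        exact Submodule.smul_mem _ a hx)

end Modules

/-! ### Additive closure and presentable objects -/

section Categories

variable {C : Type u₁} [Category.{v₁} C]

/-- `add X`: the objects isomorphic to finite direct sums of direct summands of `X`. -/
def addClosure [Preadditive C] [HasFiniteBiproducts C] (X : C) : ObjectProperty C :=
  fun Y => ∃ (m : ℕ) (Z : Fin m → C), (∀ j, Nonempty (Retract (Z j) X)) ∧ Nonempty (Y ≅ ⨁ Z)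

/-- The objects `Y` with an exact sequence `X₁ ⟶ X₀ ⟶ Y ⟶ 0`, where `X₀`, `X₁` are in `add X`. -/
def presentable [Preadditive C] [HasFiniteBiproducts C] (X : C) : ObjectProperty C :=
  fun Y => ∃ (X₁ X₀ : C) (f : X₁ ⟶ X₀) (g : X₀ ⟶ Y) (hfg : f ≫ g = 0),
    addClosure X X₁ ∧ addClosure X X₀ ∧ (ShortComplex.mk f g hfg).Exact ∧ Epi g

/-- The restriction of an endofunctor to a full subcategory that it preserves. -/
def restrict (Q : ObjectProperty C) (F : C ⥤ C) (hF : ∀ X, Q X → Q (F.obj X)) :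
    Q.FullSubcategory ⥤ Q.FullSubcategory :=
  Q.lift (Q.ι ⋙ F) fun X => hF X.obj X.property

/-! ### Selfadjoint functors and polynomials in an endofunctor -/

/-- `F` is selfadjoint: it is (left, equivalently right) adjoint to itself. -/
def IsSelfadjointFunctor (F : C ⥤ C) : Prop := Nonempty (F ⊣ F)

/-- The direct sum of a finite family of endofunctors. -/
@[simps]
def directSum [Preadditive C] [HasFiniteBiproducts C] {J : Type} [Finite J] (G : J → C ⥤ C) :
    C ⥤ C where
  obj M := ⨁ fun j => (G j).obj M
  map f := biproduct.map fun j => (G j).map f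

/-- The `m`-fold composition `F ∘ ⋯ ∘ F`, which is the identity functor for `m = 0`. -/
def iterate (F : C ⥤ C) : ℕ → (C ⥤ C)
  | 0 => 𝟭 C
  | m + 1 => iterate F m ⋙ F

/-- `g(F)` for a polynomial `g` with nonnegative integral coefficients: the direct sum, over all
exponents `m`, of `g.coeff m` copies of the `m`-th power of `F`. -/
def polyFunctor [Preadditive C] [HasFiniteBiproducts C] (g : ℕ[X]) (F : C ⥤ C) : C ⥤ C :=
  directSum fun p : (Σ m : Fin (g.natDegree + 1), Fin (g.coeff m)) => iterate F p.1

/-! ### Grothendieck groups -/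

variable (C) in
/-- The subgroup generated by the `[X₂] - [X₁] - [X₃]` for the short exact sequences
`0 ⟶ X₁ ⟶ X₂ ⟶ X₃ ⟶ 0`. -/
def exactRelations [HasZeroMorphisms C] : AddSubgroup (FreeAbelianGroup C) :=
  AddSubgroup.closure {x | ∃ T : ShortComplex C, T.ShortExact ∧
    x = FreeAbelianGroup.of T.X₂ - FreeAbelianGroup.of T.X₁ - FreeAbelianGroup.of T.X₃}

variable (C) in
/-- The Grothendieck group of an abelian category. -/
abbrev GrothendieckK0 [HasZeroMorphisms C] : Type u₁ := FreeAbelianGroup C ⧸ exactRelations C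

/-- The class `[X]` of an object. -/
def K0class [HasZeroMorphisms C] (X : C) : GrothendieckK0 C :=
  QuotientAddGroup.mk (FreeAbelianGroup.of X)

theorem IsSelfadjointFunctor.map_shortExact [HasZeroMorphisms C] {F : C ⥤ C}
    [F.PreservesZeroMorphisms] (hF : IsSelfadjointFunctor F) (T : ShortComplex C)
    (hT : T.ShortExact) : (T.map F).ShortExact := by
  obtain ⟨adj⟩ := hF
  have hl := adj.rightAdjoint_preservesLimits
  have hr := adj.leftAdjoint_preservesColimits
  have : PreservesFiniteLimits F := PreservesLimits.preservesFiniteLimits F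
  have : PreservesFiniteColimits F := PreservesColimits.preservesFiniteColimits F
  exact hT.map_of_exact F

/-- The endomorphism `[F]` of the Grothendieck group, `[X] ↦ [F X]`, induced by an exact
endofunctor `F`. -/
def K0map [HasZeroMorphisms C] (F : C ⥤ C) [F.PreservesZeroMorphisms]
    (hF : ∀ T : ShortComplex C, T.ShortExact → (T.map F).ShortExact) :
    GrothendieckK0 C →+ GrothendieckK0 C :=
  QuotientAddGroup.map _ _ (FreeAbelianGroup.map F.obj) <| by
    rw [exactRelations, AddSubgroup.closure_le]
    rintro _ ⟨T, hT, rfl⟩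
    refine AddSubgroup.subset_closure ⟨T.map F, hF T hT, ?_⟩
    simp [FreeAbelianGroup.map_of_apply]

end Categories

/-- The linear span of the classes `[L i]`, `i ∈ S`, in the Grothendieck group. -/
def classSpan {A : Type u} [Ring A] {n : ℕ} (L : Fin n → FGModuleCat.{u} A) (S : Set (Fin n)) :
    Submodule ℤ (GrothendieckK0 (FGModuleCat.{u} A)) :=
  Submodule.span ℤ ((fun i => K0class (L i)) '' S)

/-! ### The centralizer algebra and its Hom functor -/

section Centralizer

open scoped ModuleCat in
theorem finite_hom (k : Type w) {A : Type u} [Field k] [Ring A] [Algebra k A]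
    [Module.Finite k A] (X Y : FGModuleCat.{u} A) : Module.Finite (End X)ᵐᵒᵖ (X ⟶ Y) := by
  have : Module.Finite k X := Module.Finite.trans A X
  have : Module.Finite k Y := Module.Finite.trans A Y
  let φ : (X ⟶ Y) →ₗ[k] (X →ₗ[k] Y) :=
    { toFun := fun f => f.hom.hom.restrictScalars k
      map_add' := fun _ _ => rfl
      map_smul' := fun _ _ => rfl }
  have hφ : Function.Injective φ := fun f g h => by
    ext x
    exact LinearMap.congr_fun h x
  have : Module.Finite k (X ⟶ Y) := Module.Finite.of_injective φ hφ
  have : IsScalarTower k (End X)ᵐᵒᵖ (X ⟶ Y) :=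
    ⟨fun c e f => Linear.smul_comp _ _ _ c e.unop f⟩
  exact Module.Finite.of_restrictScalars_finite k (End X)ᵐᵒᵖ (X ⟶ Y)

variable (k : Type w) {A : Type u} [Field k] [Ring A] [Algebra k A] [Module.Finite k A]

/-- The functor `Hom_A(X, -)` from finitely generated `A`-modules to finitely generated modules
over the centralizer algebra `End_A(X)ᵒᵖ`. -/
def homFunctor (X : FGModuleCat.{u} A) : FGModuleCat.{u} A ⥤ FGModuleCat.{u} (End X)ᵐᵒᵖ :=
  (ModuleCat.isFG (End X)ᵐᵒᵖ).lift (preadditiveCoyonedaObj X) (finite_hom k X)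

end Centralizer

end

end SelfadjointFunctors

/-!
Write `S'` for the complement of `S`. Since `P_{S'}` is projective, a module `M` lies in `𝒩_S` if
and only if `Hom(P_{S'}, M) = 0`, that is, if and only if `I_S` annihilates `M`; and a module
belongs to `add(P_{S'})` if and only if it is projective and has no nonzero maps to the `L i` with
`i ∈ S`. As `[M] ↦ dim Hom(P_{S'}, M)` is well defined on the Grothendieck group, `M` lies in `𝒩_S`
if and only if `[M]` is in the span of the `[L i]` with `i ∈ S`, so `F` preserves `𝒩_S`. Hence for
`X` in `add(P_{S'})` and `i ∈ S` the space `Hom(F X, L i) = Hom(X, F (L i))` vanishes, so `F X` is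
in `add(P_{S'})`, and by right exactness `F` preserves the presentable modules.

The fully faithful functors `Ψ` and `Φ⁻¹` into the category of `A`-modules intertwine the two
induced functors with `F`. Adjunctions and isomorphisms between polynomials in `F` can be pulled
back along them.
-/

namespace SelfadjointFunctors

noncomputable section

/-! ### Functors intertwined with an endofunctor by a fully faithful functor -/

section Intertwine

variable {C : Type u₁} [Category.{v₁} C] {D : Type u₂} [Category.{v₂} D]
  {E : D ⥤ C} {G : D ⥤ D} {F : C ⥤ C}

theorem IsSelfadjointFunctor.of_comp_iso [E.Full] [E.Faithful] (hF : IsSelfadjointFunctor F)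
    (e : G ⋙ E ≅ E ⋙ F) : IsSelfadjointFunctor G :=
  hF.map fun adj =>
    adj.restrictFullyFaithful (.ofFullyFaithful E) (.ofFullyFaithful E) e.symm e.symm

/-- If `E` intertwines `G` and `F`, then it intertwines their powers. -/
def iterateIso (e : G ⋙ E ≅ E ⋙ F) : ∀ m, iterate G m ⋙ E ≅ E ⋙ iterate F m
  | 0 => E.leftUnitor ≪≫ E.rightUnitor.symm
  | m + 1 => Functor.associator _ _ _ ≪≫ Functor.isoWhiskerLeft _ e ≪≫
      (Functor.associator _ _ _).symm ≪≫ Functor.isoWhiskerRight (iterateIso e m) F ≪≫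
      Functor.associator _ _ _

/-- The conjugate by an equivalence `e` of the restriction of `F` to a full subcategory `Q` is
intertwined with `F` by the fully faithful functor `e.functor ⋙ Q.ι`. -/
def conjugateRestrictIso {Q : ObjectProperty C} (e : D ≌ Q.FullSubcategory) (F : C ⥤ C)
    (hF : ∀ X, Q X → Q (F.obj X)) :
    (e.functor ⋙ restrict Q F hF ⋙ e.inverse) ⋙ e.functor ⋙ Q.ι ≅ (e.functor ⋙ Q.ι) ⋙ F :=
  Functor.isoWhiskerLeft (e.functor ⋙ restrict Q F hF) (Functor.isoWhiskerRight e.counitIso Q.ι)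

variable [Preadditive C] [Preadditive D]

theorem additive_of_comp_iso [E.Faithful] [E.Additive] [F.Additive] (e : G ⋙ E ≅ E ⋙ F) :
    G.Additive :=
  have := Functor.additive_of_iso e.symm
  Functor.additive_of_comp_faithful G E

theorem linear_of_comp_iso (k : Type w) [Semiring k] [Linear k C] [Linear k D] [E.Faithful]
    [E.Linear k] [F.Linear k] (e : G ⋙ E ≅ E ⋙ F) : G.Linear k where
  map_smul f c := E.map_injective <| by
    have := Functor.linear_of_iso k e.symm
    simpa only [Functor.comp_map, E.map_smul] using (G ⋙ E).map_smul c f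

variable [HasFiniteBiproducts C] [HasFiniteBiproducts D]

section DirectSum

variable [E.Additive] {J : Type} [Finite J]

/-- An additive functor `E` commutes with finite biproducts, here combined with isomorphisms
between the summands. -/
def mapBiproductIso {X : J → D} {Y : J → C} (e : ∀ j, E.obj (X j) ≅ Y j) :
    E.obj (⨁ X) ≅ ⨁ Y :=
  E.mapBiproduct X ≪≫ biproduct.mapIso (f := E.obj ∘ X) e

theorem mapBiproductIso_hom_π {X : J → D} {Y : J → C} (e : ∀ j, E.obj (X j) ≅ Y j) (j : J) :
    (mapBiproductIso e).hom ≫ biproduct.π Y j = E.map (biproduct.π X j) ≫ (e j).hom := by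
  rw [mapBiproductIso, Iso.trans_hom, Category.assoc, biproduct.mapIso_hom, biproduct.map_π,
    ← Category.assoc, Functor.mapBiproduct_hom]
  exact congr_arg (· ≫ _) (biproduct.lift_π _ j)

theorem map_biproductMap_comp_mapBiproductIso_hom {X X' : J → D} {Y Y' : J → C}
    {e : ∀ j, E.obj (X j) ≅ Y j} {e' : ∀ j, E.obj (X' j) ≅ Y' j} {f : ∀ j, X j ⟶ X' j}
    {g : ∀ j, Y j ⟶ Y' j} (h : ∀ j, E.map (f j) ≫ (e' j).hom = (e j).hom ≫ g j) :
    E.map (biproduct.map f) ≫ (mapBiproductIso e').hom =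
      (mapBiproductIso e).hom ≫ biproduct.map g :=
  biproduct.hom_ext _ _ fun j => by
    rw [Category.assoc, mapBiproductIso_hom_π, ← E.map_comp_assoc, biproduct.map_π,
      E.map_comp_assoc, h, Category.assoc, biproduct.map_π, ← Category.assoc, ← Category.assoc,
      mapBiproductIso_hom_π]

/-- If an additive functor `E` intertwines families of endofunctors, then it intertwines their
direct sums. -/
def directSumIso {G : J → D ⥤ D} {F : J → C ⥤ C} (e : ∀ j, G j ⋙ E ≅ E ⋙ F j) :
    directSum G ⋙ E ≅ E ⋙ directSum F :=
  NatIso.ofComponents (fun M => mapBiproductIso fun j => (e j).app M) fun {M N} f =>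
    map_biproductMap_comp_mapBiproductIso_hom (e := fun j => (e j).app M)
      (e' := fun j => (e j).app N) fun j => (e j).hom.naturality f

end DirectSum

theorem nonempty_polyFunctor_iso [E.Full] [E.Faithful] [E.Additive] (e : G ⋙ E ≅ E ⋙ F)
    {g h : ℕ[X]} (i : Nonempty (polyFunctor g F ≅ polyFunctor h F)) :
    Nonempty (polyFunctor g G ≅ polyFunctor h G) :=
  i.map fun i => Functor.fullyFaithfulCancelRight E <|
    directSumIso (fun _ => iterateIso e _) ≪≫ Functor.isoWhiskerLeft E i ≪≫
      (directSumIso fun _ => iterateIso e _).symm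

end Intertwine

section Equivalences

variable {C : Type u₁} [Category.{v₁} C] {D : Type u₂} [Category.{v₂} D]

theorem isEquivalence_lift {Q : ObjectProperty C} {E : D ⥤ C} [E.Full] [E.Faithful]
    (hE : ∀ Y, Q (E.obj Y)) (h : ∀ X, Q X → E.essImage X) : (Q.lift E hE).IsEquivalence where
  essSurj.mem_essImage X := by
    obtain ⟨Y, ⟨e⟩⟩ := h X.obj X.property
    exact ⟨Y, ⟨Q.fullyFaithfulι.preimageIso e⟩⟩

variable [Preadditive C] [Preadditive D] (E : D ⥤ C) [E.IsEquivalence] [E.Additive]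

instance additive_inv : E.inv.Additive :=
  have : E.asEquivalence.functor.Additive := ‹E.Additive›
  E.asEquivalence.inverse_additive

instance linear_inv (k : Type w) [Semiring k] [Linear k C] [Linear k D] [E.Linear k] :
    E.inv.Linear k :=
  have : E.asEquivalence.functor.Linear k := ‹E.Linear k›
  E.asEquivalence.inverseLinear k

end Equivalences

/-! ### The additive closure of an object -/

section AddClosure

variable {C : Type u₁} [Category.{v₁} C] [Preadditive C] [HasFiniteBiproducts C] {X Y Z : C}

theorem addClosure.exists_sum_eq_id (h : addClosure X Y) :
    ∃ (m : ℕ) (a : Fin m → (Y ⟶ X)) (b : Fin m → (X ⟶ Y)), ∑ j, a j ≫ b j = 𝟙 Y := by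
  obtain ⟨m, Z, hZ, ⟨e⟩⟩ := h
  refine ⟨m, fun j => e.hom ≫ biproduct.π Z j ≫ (hZ j).some.i,
    fun j => (hZ j).some.r ≫ biproduct.ι Z j ≫ e.inv, ?_⟩
  calc
    _ = ∑ j, e.hom ≫ (biproduct.π Z j ≫ biproduct.ι Z j) ≫ e.inv := by simp
    _ = 𝟙 Y := by
      simp_rw [← Preadditive.comp_sum, ← Preadditive.sum_comp, biproduct.total, Category.id_comp,
        e.hom_inv_id]

theorem addClosure.hom_ext (h : addClosure X Y) {f g : Y ⟶ Z}
    (hfg : ∀ t : X ⟶ Y, t ≫ f = t ≫ g) : f = g := by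
  obtain ⟨m, a, b, hab⟩ := h.exists_sum_eq_id
  rw [← Category.id_comp f, ← Category.id_comp g, ← hab]
  simp only [Preadditive.sum_comp, Category.assoc, hfg]

theorem addClosure.subsingleton_hom [Subsingleton (X ⟶ Z)] (h : addClosure X Y) :
    Subsingleton (Y ⟶ Z) :=
  ⟨fun _ _ => h.hom_ext fun _ => Subsingleton.elim _ _⟩

theorem addClosure.projective [Projective X] (h : addClosure X Y) : Projective Y where
  factors f e he := by
    obtain ⟨m, a, b, hab⟩ := h.exists_sum_eq_id
    refine ⟨∑ j, a j ≫ Projective.factorThru (b j ≫ f) e, ?_⟩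
    simp_rw [Preadditive.sum_comp, Category.assoc, Projective.factorThru_comp, ← Category.assoc,
      ← Preadditive.sum_comp, hab, Category.id_comp]

theorem addClosure.of_iso (h : addClosure X Y) (e : Z ≅ Y) : addClosure X Z := by
  obtain ⟨m, W, hW, ⟨i⟩⟩ := h
  exact ⟨m, W, hW, ⟨e ≪≫ i⟩⟩

theorem addClosure_of_retract (h : Retract Y X) : addClosure X Y :=
  ⟨1, fun _ => Y, fun _ => ⟨h⟩, ⟨(biproductUniqueIso fun _ : Fin 1 => Y).symm⟩⟩

theorem addClosure_biproduct {J : Type} [Finite J] {Y : J → C} (h : ∀ j, addClosure X (Y j)) :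
    addClosure X (⨁ Y) := by
  choose m Z hZ e using h
  obtain ⟨l, ⟨σ⟩⟩ := Finite.exists_equiv_fin (Σ j, Fin (m j))
  exact ⟨l, fun q => Z (σ.symm q).1 (σ.symm q).2, fun q => hZ _ _,
    ⟨biproduct.mapIso (fun j => (e j).some) ≪≫ biproductBiproductIso _ _ ≪≫
      (biproduct.reindex σ.symm _).symm⟩⟩

theorem addClosure_of_isZero (X : C) (hY : IsZero Y) : addClosure X Y :=
  (addClosure_biproduct (Y := Fin.elim0) fun j => j.elim0).of_iso <|
    hY.iso <| (IsZero.iff_id_eq_zero _).2 <| biproduct.hom_ext _ _ fun j => j.elim0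

theorem addClosure.biprod [HasBinaryBiproduct Y Z] (hY : addClosure X Y) (hZ : addClosure X Z) :
    addClosure X (Y ⊞ Z) :=
  have h : addClosure X (⨁ pairFunction Y Z) :=
    addClosure_biproduct fun | .left => hY | .right => hZ
  h.of_iso (biprod.uniqueUpToIso Y Z
    ((Bicone.toBinaryBiconeIsBilimit _).symm (biproduct.isBilimit (pairFunction Y Z)))).symm

theorem addClosure.of_splitting {T : ShortComplex C} (σ : T.Splitting) (h₁ : addClosure X T.X₁)
    (h₃ : addClosure X T.X₃) : addClosure X T.X₂ :=
  have := hasBinaryBiproducts_of_finite_biproducts C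
  (h₁.biprod h₃).of_iso σ.isoBinaryBiproduct

end AddClosure

/-! ### Presentable objects and the Hom functor -/

section Presentable

variable {C : Type u₁} [Category.{v₁} C]

section Preadditive

variable [Preadditive C] [HasFiniteBiproducts C] {X Y Z : C}

theorem addClosure.exists_map_eq (h : addClosure X Y)
    (φ : (preadditiveCoyonedaObj X).obj Y ⟶ (preadditiveCoyonedaObj X).obj Z) :
    ∃ u : Y ⟶ Z, (preadditiveCoyonedaObj X).map u = φ := by
  obtain ⟨m, a, b, hab⟩ := h.exists_sum_eq_id
  let ψ : (X ⟶ Y) →ₗ[(End X)ᵐᵒᵖ] (X ⟶ Z) := φ.hom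
  have map_comp (c : End X) (t : X ⟶ Y) : ψ (c ≫ t) = c ≫ ψ t := ψ.map_smul (MulOpposite.op c) t
  refine ⟨∑ j, a j ≫ ψ (b j), ModuleCat.hom_ext (LinearMap.ext fun (t : X ⟶ Y) => ?_)⟩
  calc
    t ≫ ∑ j, a j ≫ ψ (b j) = ψ (t ≫ ∑ j, a j ≫ b j) := by
      simp_rw [Preadditive.comp_sum, map_sum, ← Category.assoc, map_comp]
    _ = ψ t := by rw [hab, Category.comp_id]

instance faithful_presentable_preadditiveCoyonedaObj (X : C) :
    ((presentable X).ι ⋙ preadditiveCoyonedaObj X).Faithful where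
  map_injective {Y Z f g} h := by
    obtain ⟨_, _, _, q, _, _, h₀, _, _⟩ := Y.property
    have comp_eq (t : X ⟶ Y.obj) : t ≫ f.hom = t ≫ g.hom :=
      LinearMap.congr_fun (congr_arg ModuleCat.Hom.hom h) t
    refine ObjectProperty.hom_ext _ ((cancel_epi q).1 (h₀.hom_ext fun t => ?_))
    rw [← Category.assoc, ← Category.assoc, comp_eq]

/-- The morphisms from `X` to the `l`-th power of `X` as the free module of rank `l` over the
centralizer ring of `X`. -/
def homBiproductEquiv (X : C) (l : ℕ) :
    (X ⟶ ⨁ fun _ : Fin l => X) ≃ₗ[(End X)ᵐᵒᵖ] (Fin l → (End X)ᵐᵒᵖ) where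
  toFun t j := MulOpposite.op (t ≫ biproduct.π (fun _ : Fin l => X) j)
  map_add' s t := funext fun _ => congr_arg MulOpposite.op (Preadditive.add_comp _ _ _ s t _)
  map_smul' c t := funext fun _ => congr_arg MulOpposite.op (Category.assoc c.unop t _)
  invFun x := biproduct.lift fun j => (x j).unop
  left_inv _ := biproduct.hom_ext _ _ fun j => biproduct.lift_π _ j
  right_inv _ := funext fun j => congr_arg MulOpposite.op (biproduct.lift_π _ j)

end Preadditive

attribute [local instance] Abelian.hasFiniteBiproducts

variable [Abelian C]

instance full_presentable_preadditiveCoyonedaObj (X : C) [Projective X] :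
    ((presentable X).ι ⋙ preadditiveCoyonedaObj X).Full where
  map_surjective {Y Z} φ := by
    obtain ⟨X₁, X₀, p, q, hpq, h₁, h₀, hex, hq⟩ := Y.property
    let H := preadditiveCoyonedaObj X
    obtain ⟨u, hu⟩ := h₀.exists_map_eq (H.map q ≫ φ)
    have hpu : p ≫ u = 0 := h₁.hom_ext fun t => by
      have : H.map (p ≫ u) = 0 := by
        rw [H.map_comp, hu, ← H.map_comp_assoc, hpq, H.map_zero, Limits.zero_comp]
      rw [Limits.comp_zero]
      exact LinearMap.congr_fun (congr_arg ModuleCat.Hom.hom this) t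
    refine ⟨ObjectProperty.homMk (hex.desc u hpu), ?_⟩
    have : Epi (H.map q) := inferInstance
    rw [← cancel_epi (H.map q)]
    exact (H.map_comp _ _).symm.trans ((congr_arg H.map (hex.g_desc u hpu)).trans hu)

theorem mem_essImage_presentable_preadditiveCoyonedaObj (X : C) [Projective X]
    (M : ModuleCat.{v₁} (End X)ᵐᵒᵖ) [Module.FinitePresentation (End X)ᵐᵒᵖ M] :
    ((presentable X).ι ⋙ preadditiveCoyonedaObj X).essImage M := by
  obtain ⟨n, m, f, g, hf, hgf⟩ := Module.FinitePresentation.exists_fin' (End X)ᵐᵒᵖ M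
  let H := preadditiveCoyonedaObj X
  let Q (l : ℕ) : C := ⨁ fun _ : Fin l => X
  have hQ (l : ℕ) : addClosure X (Q l) :=
    addClosure_biproduct fun _ => addClosure_of_retract (.refl X)
  let ε (l : ℕ) : H.obj (Q l) ≅ ModuleCat.of _ (Fin l → (End X)ᵐᵒᵖ) :=
    (homBiproductEquiv X l).toModuleIso
  obtain ⟨p, hp⟩ := (hQ m).exists_map_eq ((ε m).hom ≫ ModuleCat.ofHom g ≫ (ε n).inv)
  let T := ShortComplex.mk p (cokernel.π p) (cokernel.condition p)
  have hT : T.Exact := ShortComplex.exact_of_g_is_cokernel _ (cokernelIsCokernel p)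
  let M' := ShortComplex.moduleCatMk g f hgf.linearMap_comp_eq_zero
  have hM' : M'.Exact := ShortComplex.Exact.moduleCat_of_range_eq_ker _ _ hgf.linearMap_ker_eq.symm
  have : Epi M'.g := (ModuleCat.epi_iff_surjective _).2 hf
  have : Epi (T.map H).g := inferInstanceAs (Epi (H.map (cokernel.π p)))
  refine ⟨⟨cokernel p, Q m, Q n, p, cokernel.π p, cokernel.condition p, hQ m, hQ n, hT,
    inferInstance⟩, ⟨CokernelCofork.mapIsoOfIsColimit (hT.map H).gIsCokernel hM'.gIsCokernel <|
      Arrow.isoMk (ε m) (ε n) ?_⟩⟩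
  exact ((Iso.eq_comp_inv _).1 (hp.trans (Category.assoc _ _ _).symm)).symm

theorem presentable.map {X : C} {F : C ⥤ C} [F.PreservesZeroMorphisms]
    [PreservesFiniteColimits F] (hF : ∀ Y, addClosure X Y → addClosure X (F.obj Y)) (Y : C)
    (hY : presentable X Y) : presentable X (F.obj Y) := by
  obtain ⟨X₁, X₀, f, g, hfg, h₁, h₀, hex, hg⟩ := hY
  exact ⟨_, _, F.map f, F.map g, by rw [← F.map_comp, hfg, F.map_zero], hF _ h₁, hF _ h₀,
    hex.map_of_epi_of_preservesCokernel F hg inferInstance, inferInstance⟩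

end Presentable

section HomFunctor

open scoped ModuleCat in
theorem moduleFinite_hom (k : Type w) {A : Type u} [Field k] [Ring A] [Algebra k A]
    [Module.Finite k A] (X Y : FGModuleCat.{u} A) : Module.Finite k (X ⟶ Y) := by
  have : Module.Finite k X := Module.Finite.trans A X
  have : Module.Finite k Y := Module.Finite.trans A Y
  let φ : (X ⟶ Y) →ₗ[k] (X →ₗ[k] Y) :=
    { toFun := fun f => f.hom.hom.restrictScalars k
      map_add' := fun _ _ => rfl
      map_smul' := fun _ _ => rfl }
  exact Module.Finite.of_injective φ fun f g h => by
    ext x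
    exact LinearMap.congr_fun h x

theorem isNoetherianRing_end_mulOpposite (k : Type w) {A : Type u} [Field k] [Ring A]
    [Algebra k A] [Module.Finite k A] (X : FGModuleCat.{u} A) : IsNoetherianRing (End X)ᵐᵒᵖ :=
  have : Module.Finite k (End X) := moduleFinite_hom k X X
  have : Module.Finite k (End X)ᵐᵒᵖ := .equiv (MulOpposite.opLinearEquiv k : End X ≃ₗ[k] _)
  .of_finite k _

variable (k : Type w) {A : Type u} [Field k] [Ring A] [Algebra k A] [Module.Finite k A]
  (X : FGModuleCat.{u} A)

instance additive_homFunctor : (homFunctor k X).Additive where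
  map_add {_ _ f g} :=
    FGModuleCat.hom_ext (LinearMap.ext fun t => Preadditive.comp_add _ _ _ t f g)

instance linear_homFunctor : (homFunctor k X).Linear k where
  map_smul {Y _} f c := FGModuleCat.hom_ext (LinearMap.ext fun (t : X ⟶ Y) =>
    ((Linear.comp_smul _ _ _ t c f).trans (by simp) :
      t ≫ (c • f) = (c • 𝟙 X) ≫ t ≫ f))

instance faithful_presentable_homFunctor : ((presentable X).ι ⋙ homFunctor k X).Faithful :=
  have : (((presentable X).ι ⋙ homFunctor k X) ⋙ (ModuleCat.isFG (End X)ᵐᵒᵖ).ι).Faithful :=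
    faithful_presentable_preadditiveCoyonedaObj X
  .of_comp _ (ModuleCat.isFG (End X)ᵐᵒᵖ).ι

variable [Projective X]

instance full_presentable_homFunctor : ((presentable X).ι ⋙ homFunctor k X).Full :=
  have : IsNoetherianRing A := .of_finite k A
  have : (((presentable X).ι ⋙ homFunctor k X) ⋙ (ModuleCat.isFG (End X)ᵐᵒᵖ).ι).Full :=
    full_presentable_preadditiveCoyonedaObj X
  .of_comp_faithful _ (ModuleCat.isFG (End X)ᵐᵒᵖ).ι

instance isEquivalence_presentable_homFunctor :
    ((presentable X).ι ⋙ homFunctor k X).IsEquivalence where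
  essSurj.mem_essImage M := by
    have : IsNoetherianRing A := .of_finite k A
    have := isNoetherianRing_end_mulOpposite k X
    have : Module.FinitePresentation (End X)ᵐᵒᵖ M.obj :=
      Module.finitePresentation_of_finite (End X)ᵐᵒᵖ M
    obtain ⟨Y, ⟨e⟩⟩ := mem_essImage_presentable_preadditiveCoyonedaObj X M.obj
    exact ⟨Y, ⟨(ModuleCat.isFG (End X)ᵐᵒᵖ).fullyFaithfulι.preimageIso e⟩⟩

end HomFunctor

/-! ### Finitely generated modules -/

section FGModules

variable {A : Type u} [Ring A] {X Y : FGModuleCat.{u} A}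

/-- Morphisms of finitely generated modules as linear maps. -/
def homEquivLinearMap (X Y : FGModuleCat.{u} A) : (X ⟶ Y) ≃ (X →ₗ[A] Y) :=
  (ModuleCat.isFG A).fullyFaithfulι.homEquiv.trans ModuleCat.homEquiv

theorem subsingleton_linearMap_iff :
    Subsingleton (X →ₗ[A] Y) ↔ Subsingleton (X ⟶ Y) :=
  (homEquivLinearMap X Y).subsingleton_congr.symm

theorem epi_iff_surjective (f : X ⟶ Y) : Epi f ↔ Function.Surjective f.hom.hom := by
  rw [← ModuleCat.epi_iff_surjective]
  exact ⟨fun _ => inferInstanceAs (Epi ((forget₂ (FGModuleCat A) (ModuleCat A)).map f)),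
    fun h => (forget₂ (FGModuleCat A) (ModuleCat A)).epi_of_epi_map h⟩

theorem projective_iff : Projective X ↔ Module.Projective A X := by
  refine ⟨fun _ => ?_, fun _ => ⟨fun f e he => ?_⟩⟩
  · obtain ⟨m, p, hp⟩ := Module.Finite.exists_fin' A X
    let q : FGModuleCat.of A (Fin m → A) ⟶ X := FGModuleCat.ofHom p
    have : Epi q := (epi_iff_surjective q).2 hp
    exact Module.Projective.of_split (Projective.factorThru (𝟙 X) q).hom.hom p
      (congr_arg (fun f => f.hom.hom) (Projective.factorThru_comp (𝟙 X) q))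
  · obtain ⟨h, hh⟩ := Module.projective_lifting_property e.hom.hom f.hom.hom
      ((epi_iff_surjective e).1 he)
    exact ⟨FGModuleCat.ofHom h, FGModuleCat.hom_ext hh⟩

theorem isZero_of_subsingleton [Subsingleton X] : IsZero X :=
  (IsZero.iff_id_eq_zero _).2 (FGModuleCat.hom_ext (LinearMap.ext fun _ => Subsingleton.elim _ _))

theorem ne_zero_of_epi [IsSimpleModule A Y] (f : X ⟶ Y) [Epi f] : f ≠ 0 := by
  have := IsSimpleModule.nontrivial A Y
  rintro rfl
  exact LinearMap.ne_zero_of_surjective ((epi_iff_surjective (0 : X ⟶ Y)).1 ‹_›) rfl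

theorem IsCompleteSimpleList.isZero_or_exists_epi {n : ℕ} {L : Fin n → FGModuleCat.{u} A}
    (hL : IsCompleteSimpleList L) (M : FGModuleCat.{u} A) :
    IsZero M ∨ ∃ (i : Fin n) (q : M ⟶ L i), Epi q := by
  rcases subsingleton_or_nontrivial M with _ | _
  · exact .inl isZero_of_subsingleton
  · obtain ⟨N, hN⟩ := IsCoatomic.exists_coatom (Submodule A M)
    obtain ⟨i, ⟨e⟩⟩ := hL.complete (FGModuleCat.of A (M ⧸ N)) (isSimpleModule_iff_isCoatom.2 hN)
    have : Epi (FGModuleCat.ofHom N.mkQ : M ⟶ FGModuleCat.of A (M ⧸ N)) :=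
      (epi_iff_surjective _).2 N.mkQ_surjective
    exact .inr ⟨i, FGModuleCat.ofHom N.mkQ ≫ e.hom, epi_comp _ _⟩

theorem length_kernel_lt [IsArtinianRing A] {f : X ⟶ Y} (hf : f ≠ 0) :
    Module.length A (kernel f : FGModuleCat.{u} A) < Module.length A X := by
  have hinj : Function.Injective (kernel.ι f).hom.hom :=
    (ModuleCat.mono_iff_injective _).1
      (inferInstanceAs (Mono ((forget₂ (FGModuleCat A) (ModuleCat A)).map (kernel.ι f))))
  rw [(LinearEquiv.ofInjective _ hinj).length_eq]
  refine Submodule.length_lt fun htop => hf ?_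
  have : Epi (kernel.ι f) := (epi_iff_surjective _).2 (LinearMap.range_eq_top.1 htop)
  exact eq_zero_of_epi_kernel f

theorem kernel_induction [IsArtinianRing A] {motive : FGModuleCat.{u} A → Prop}
    (ind : ∀ M, (∀ {N : FGModuleCat.{u} A} (f : M ⟶ N), f ≠ 0 → motive (kernel f)) → motive M)
    (M : FGModuleCat.{u} A) : motive M := by
  induction hl : Module.length A M using WellFoundedLT.induction generalizing M with
  | ind l ih => exact ind M fun f hf => ih _ (hl ▸ length_kernel_lt hf) (kernel f) rfl

end FGModules

/-! ### Projective covers and composition multiplicities -/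

section Covers

variable {A : Type u} [Ring A]

theorem exists_linearMap_ne_zero_of_subquotient {P M : Type*} [AddCommGroup P] [Module A P]
    [Module.Projective A P] [AddCommGroup M] [Module A M] {N : Submodule A M}
    {N' : Submodule A N} {f : P →ₗ[A] N ⧸ N'} (hf : f ≠ 0) : ∃ g : P →ₗ[A] M, g ≠ 0 := by
  obtain ⟨g, rfl⟩ := Module.projective_lifting_property N'.mkQ f N'.mkQ_surjective
  refine ⟨N.subtype ∘ₗ g, fun h => hf ?_⟩
  ext x
  have hx : g x = 0 := Subtype.ext (LinearMap.congr_fun h x)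
  rw [LinearMap.comp_apply, hx, map_zero, LinearMap.zero_apply]

theorem exists_linearMap_subfactor_ne_zero {P : Type*} {M : Type u} [AddCommGroup P] [Module A P]
    [AddCommGroup M] [Module A M] {s : CompositionSeries (Submodule A M)} (h₀ : s.head = ⊥)
    (h₁ : s.last = ⊤) {f : P →ₗ[A] M} (hf : f ≠ 0) :
    ∃ (j : Fin s.length) (g : P →ₗ[A] Subfactor s j), g ≠ 0 := by
  by_contra! hs
  refine hf (LinearMap.range_eq_bot.1 (le_bot_iff.1 ?_))
  suffices H : ∀ j, LinearMap.range f ≤ s j from h₀ ▸ H 0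
  intro j
  induction j using Fin.reverseInduction with
  | last => exact le_top.trans h₁.ge
  | cast j ih =>
    rintro _ ⟨x, rfl⟩
    exact (Submodule.Quotient.mk_eq_zero ((s j.castSucc).submoduleOf (s j.succ))).1 <|
      LinearMap.congr_fun (hs j (((s j.castSucc).submoduleOf (s j.succ)).mkQ ∘ₗ
        f.codRestrict (s j.succ) fun x => ih ⟨x, rfl⟩)) x

namespace IsProjectiveCover

variable {P L M : FGModuleCat.{u} A} {π : P ⟶ L}

theorem epi (h : IsProjectiveCover π) : Epi π :=
  (epi_iff_surjective π).2 h.surjective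

theorem epi_of_epi_comp (h : IsProjectiveCover π) {X : FGModuleCat.{u} A} (r : X ⟶ P)
    [Epi (r ≫ π)] : Epi r := by
  have hs : Function.Surjective (r ≫ π).hom.hom := (epi_iff_surjective _).1 inferInstance
  refine (epi_iff_surjective r).2 (LinearMap.range_eq_top.1 (h.superfluous _ ?_))
  refine eq_top_iff.2 fun y _ => ?_
  obtain ⟨x, hx : π.hom.hom (r.hom.hom x) = π.hom.hom y⟩ := hs (π.hom.hom y)
  rw [← add_sub_cancel (r.hom.hom x) y]
  refine Submodule.add_mem_sup ⟨x, rfl⟩ ?_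
  rw [LinearMap.mem_ker, map_sub, hx, sub_self]

variable [IsSimpleModule A L]

theorem ker_eq (h : IsProjectiveCover π) {V : Type*} [AddCommGroup V] [Module A V]
    [IsSimpleModule A V] {f : P →ₗ[A] V} (hf : f ≠ 0) :
    LinearMap.ker f = LinearMap.ker π.hom.hom := by
  have hK : IsCoatom (LinearMap.ker f) :=
    LinearMap.isCoatom_ker_of_surjective (LinearMap.surjective_of_ne_zero hf)
  have hK' : IsCoatom (LinearMap.ker π.hom.hom) :=
    LinearMap.isCoatom_ker_of_surjective h.surjective
  have hne : LinearMap.ker f ⊔ LinearMap.ker π.hom.hom ≠ ⊤ := fun e => hK.1 (h.superfluous _ e)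
  rw [← (hK.le_iff.1 le_sup_left).resolve_left hne]
  exact (hK'.le_iff.1 le_sup_right).resolve_left hne

theorem nonempty_linearEquiv (h : IsProjectiveCover π) {V : Type*} [AddCommGroup V]
    [Module A V] [IsSimpleModule A V] {f : P →ₗ[A] V} (hf : f ≠ 0) : Nonempty (V ≃ₗ[A] L) :=
  ⟨(f.quotKerEquivOfSurjective (LinearMap.surjective_of_ne_zero hf)).symm ≪≫ₗ
    Submodule.quotEquivOfEq _ _ (h.ker_eq hf) ≪≫ₗ
    π.hom.hom.quotKerEquivOfSurjective h.surjective⟩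

theorem nonempty_linearEquiv_iff (h : IsProjectiveCover π) {V : Type*} [AddCommGroup V]
    [Module A V] [IsSimpleModule A V] :
    Nonempty (V ≃ₗ[A] L) ↔ ∃ f : P →ₗ[A] V, f ≠ 0 := by
  have := IsSimpleModule.nontrivial A V
  exact ⟨fun ⟨e⟩ => ⟨e.symm.toLinearMap ∘ₗ π.hom.hom,
    LinearMap.ne_zero_of_surjective (e.symm.surjective.comp h.surjective)⟩,
    fun ⟨_, hf⟩ => h.nonempty_linearEquiv hf⟩

theorem exists_subfactor_equiv_iff (h : IsProjectiveCover π)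
    {s : CompositionSeries (Submodule A M)} (h₀ : s.head = ⊥) (h₁ : s.last = ⊤) :
    (∃ j, Nonempty (Subfactor s j ≃ₗ[A] L)) ↔ ∃ f : P →ₗ[A] M, f ≠ 0 := by
  have (j : Fin s.length) : IsSimpleModule A (Subfactor s j) :=
    (covBy_iff_quot_is_simple (s.step j).le).1 (s.step j)
  have := h.projective
  simp_rw [h.nonempty_linearEquiv_iff]
  exact ⟨fun ⟨j, g, hg⟩ => exists_linearMap_ne_zero_of_subquotient hg,
    fun ⟨f, hf⟩ => exists_linearMap_subfactor_ne_zero h₀ h₁ hf⟩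

theorem compositionMultiplicity_eq_zero_iff [IsArtinianRing A] (h : IsProjectiveCover π) :
    compositionMultiplicity M L = 0 ↔ Subsingleton (P ⟶ M) := by
  obtain ⟨s₀, h₀, h₁⟩ := exists_compositionSeries_of_isNoetherian_isArtinian A M
  obtain ⟨s, h₀, h₁, hs⟩ := Nat.sInf_mem (s := {m | ∃ s : CompositionSeries (Submodule A M),
    s.head = ⊥ ∧ s.last = ⊤ ∧ m = Nat.card {j : Fin s.length // Nonempty (Subfactor s j ≃ₗ[A] L)}})
    ⟨_, s₀, h₀, h₁, rfl⟩
  rw [compositionMultiplicity, hs, Finite.card_eq_zero_iff, isEmpty_subtype, ← not_exists,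
    h.exists_subfactor_equiv_iff h₀ h₁, not_exists_not, ← subsingleton_linearMap_iff,
    subsingleton_iff_forall_eq 0]

end IsProjectiveCover

end Covers

/-! ### Direct sums of projective covers -/

section Hom

variable {C : Type u₁} [Category.{v₁} C] {X Y Z : C}

theorem subsingleton_hom_of_mono (f : Y ⟶ Z) [Mono f] [Subsingleton (X ⟶ Z)] :
    Subsingleton (X ⟶ Y) :=
  ⟨fun _ _ => (cancel_mono f).1 (Subsingleton.elim _ _)⟩

theorem subsingleton_hom_of_projective_of_epi [Projective X] (f : Y ⟶ Z) [Epi f]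
    [Subsingleton (X ⟶ Y)] : Subsingleton (X ⟶ Z) :=
  ⟨fun g h => by
    rw [← Projective.factorThru_comp g f, ← Projective.factorThru_comp h f,
      Subsingleton.elim (Projective.factorThru g f)]⟩

theorem projective_biproduct [HasZeroMorphisms C] {J : Type} (P : J → C) [HasBiproduct P]
    [∀ j, Projective (P j)] : Projective (⨁ P) where
  factors f e _ := ⟨biproduct.desc fun j => Projective.factorThru (biproduct.ι P j ≫ f) e,
    biproduct.hom_ext' _ _ fun j => by
      rw [← Category.assoc, biproduct.ι_desc, Projective.factorThru_comp]⟩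

end Hom

section CoverSum

variable {A : Type u} [Ring A] {n : ℕ} {L P : Fin n → FGModuleCat.{u} A} {π : ∀ i, P i ⟶ L i}

theorem projective_coverSum (hP : ∀ i, IsProjectiveCover (π i)) (T : Set (Fin n)) :
    Projective (coverSum P T) :=
  have (i : T) : Projective (P i) := projective_iff.2 (hP i).projective
  projective_biproduct _

theorem addClosure_coverSum_of_mem (P : Fin n → FGModuleCat.{u} A) {T : Set (Fin n)} {i : Fin n}
    (hi : i ∈ T) : addClosure (coverSum P T) (P i) :=
  addClosure_of_retract ⟨biproduct.ι (fun j : T => P j) ⟨i, hi⟩,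
    biproduct.π (fun j : T => P j) ⟨i, hi⟩, biproduct.ι_π_self (fun j : T => P j) ⟨i, hi⟩⟩

theorem subsingleton_coverSum_hom_iff {T : Set (Fin n)} {M : FGModuleCat.{u} A} :
    Subsingleton (coverSum P T ⟶ M) ↔ ∀ i ∈ T, Subsingleton (P i ⟶ M) :=
  ⟨fun _ _ hi => (addClosure_coverSum_of_mem P hi).subsingleton_hom, fun h =>
    ⟨fun _ _ => biproduct.hom_ext' _ _ fun i => (h i i.2).elim _ _⟩⟩

theorem subsingleton_hom_simple_iff (hL : IsCompleteSimpleList L)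
    (hP : ∀ i, IsProjectiveCover (π i)) {i j : Fin n} : Subsingleton (P i ⟶ L j) ↔ i ≠ j := by
  have := hL.simple
  have h : (∃ f : P i →ₗ[A] L j, f ≠ 0) ↔ i = j := (hP i).nonempty_linearEquiv_iff.symm.trans
    ⟨fun ⟨e⟩ => (hL.pairwise j i ⟨e.toFGModuleCatIso⟩).symm, fun h => h ▸ ⟨.refl A _⟩⟩
  rw [← subsingleton_linearMap_iff, subsingleton_iff_forall_eq 0, ← not_exists_not, h]

theorem subsingleton_coverSum_hom_simple_iff (hL : IsCompleteSimpleList L)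
    (hP : ∀ i, IsProjectiveCover (π i)) {T : Set (Fin n)} {i : Fin n} :
    Subsingleton (coverSum P T ⟶ L i) ↔ i ∉ T := by
  simp_rw [subsingleton_coverSum_hom_iff, subsingleton_hom_simple_iff hL hP]
  exact ⟨fun h hi => h i hi rfl, fun hi j hj hji => hi (hji ▸ hj)⟩

variable [IsArtinianRing A]

theorem serre_iff (hL : IsCompleteSimpleList L) (hP : ∀ i, IsProjectiveCover (π i))
    {S : Set (Fin n)} {M : FGModuleCat.{u} A} :
    serre L S M ↔ Subsingleton (coverSum P Sᶜ ⟶ M) := by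
  have := hL.simple
  simp_rw [subsingleton_coverSum_hom_iff, serre, ← (hP _).compositionMultiplicity_eq_zero_iff]
  exact forall_congr' fun i => not_imp_comm

theorem addClosure_coverSum_iff (hL : IsCompleteSimpleList L)
    (hP : ∀ i, IsProjectiveCover (π i)) {T : Set (Fin n)} {X : FGModuleCat.{u} A} :
    addClosure (coverSum P T) X ↔ Projective X ∧ ∀ i ∉ T, Subsingleton (X ⟶ L i) := by
  have := hL.simple
  have := projective_coverSum hP T
  refine ⟨fun h => ⟨h.projective, fun i hi => ?_⟩, fun h => ?_⟩
  · have := (subsingleton_coverSum_hom_simple_iff hL hP).2 hi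
    exact h.subsingleton_hom
  induction X using kernel_induction with | ind X ih
  obtain ⟨_, hXL⟩ := h
  rcases hL.isZero_or_exists_epi X with hX | ⟨i, q, _⟩
  · exact addClosure_of_isZero _ hX
  have hi : i ∈ T := by_contra fun hi => ne_zero_of_epi q ((hXL i hi).elim q 0)
  -- The lift of `q` to the projective cover of `L i` is a split epimorphism `X ⟶ P i`.
  have : Projective (P i) := projective_iff.2 (hP i).projective
  have := (hP i).epi
  let r : X ⟶ P i := Projective.factorThru q (π i)
  have hr : r ≫ π i = q := Projective.factorThru_comp q (π i)
  have : Epi (r ≫ π i) := by rwa [hr]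
  have := (hP i).epi_of_epi_comp r
  let σ := ShortComplex.Splitting.ofExactOfSection _ (ShortComplex.exact_kernel r)
    (Projective.factorThru (𝟙 _) r) (Projective.factorThru_comp _ _) inferInstance
  have hker : addClosure X (kernel r) := addClosure_of_retract ⟨kernel.ι r, σ.r, σ.f_r⟩
  refine .of_splitting σ (ih r ?_ ⟨hker.projective, fun j hj => ?_⟩)
    (addClosure_coverSum_of_mem P hi)
  · intro h
    exact ne_zero_of_epi (r ≫ π i) (by rw [h, Limits.zero_comp])
  · have := hXL j hj
    exact hker.subsingleton_hom

end CoverSum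

/-! ### The Grothendieck group -/

section Grothendieck

variable {C : Type u₁} [Category.{v₁} C] [Abelian C]

theorem K0class_eq_add {T : ShortComplex C} (hT : T.ShortExact) :
    K0class T.X₂ = K0class T.X₁ + K0class T.X₃ := by
  have h : FreeAbelianGroup.of T.X₂ - FreeAbelianGroup.of T.X₁ - FreeAbelianGroup.of T.X₃ ∈
      exactRelations C := AddSubgroup.subset_closure ⟨T, hT, rfl⟩
  rw [← QuotientAddGroup.eq_zero_iff, QuotientAddGroup.mk_sub, QuotientAddGroup.mk_sub, sub_sub,
    sub_eq_zero] at h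
  exact h

theorem K0class_eq_kernel_add {X Y : C} (f : X ⟶ Y) [Epi f] :
    K0class X = K0class (kernel f) + K0class Y :=
  K0class_eq_add (.mk (ShortComplex.exact_kernel f))

theorem K0class_of_isZero {Z : C} (hZ : IsZero Z) : K0class Z = 0 := by
  have h : K0class Z = K0class Z + K0class Z :=
    K0class_eq_add (T := .mk (0 : Z ⟶ Z) (0 : Z ⟶ Z) Limits.comp_zero)
      (ShortComplex.Splitting.shortExact
        ⟨0, 0, hZ.eq_of_src _ _, hZ.eq_of_src _ _, hZ.eq_of_src _ _⟩)
  exact left_eq_add.1 h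

variable (k : Type w) [Field k] [Linear k C] (P : C) [Projective P]

theorem finrank_hom_eq_add {T : ShortComplex C} (hT : T.ShortExact)
    [Module.Finite k (P ⟶ T.X₂)] :
    Module.finrank k (P ⟶ T.X₂) = Module.finrank k (P ⟶ T.X₁) + Module.finrank k (P ⟶ T.X₃) := by
  have := hT.mono_f
  have := hT.epi_g
  let φ := Linear.rightComp k P T.f
  let ψ := Linear.rightComp k P T.g
  have hφ : Function.Injective φ := fun a b h => (cancel_mono T.f).1 h
  have hψ : LinearMap.range ψ = ⊤ := LinearMap.range_eq_top.2 fun a =>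
    ⟨Projective.factorThru a T.g, Projective.factorThru_comp a T.g⟩
  have hker : LinearMap.ker ψ = LinearMap.range φ := by
    ext a
    refine ⟨fun ha => ⟨hT.exact.liftFromProjective a ha, hT.exact.liftFromProjective_comp a ha⟩, ?_⟩
    rintro ⟨b, rfl⟩
    exact (Category.assoc b T.f T.g).trans (by rw [T.zero, Limits.comp_zero])
  rw [← ψ.finrank_range_add_finrank_ker, hψ, hker, finrank_top, LinearMap.finrank_range_of_inj hφ,
    add_comm]

/-- The additive function `[M] ↦ dim Hom(P, M)` on the Grothendieck group, for a projective
object `P`. -/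
def dimHom [∀ M, Module.Finite k (P ⟶ M)] : GrothendieckK0 C →+ ℤ :=
  QuotientAddGroup.lift _ (FreeAbelianGroup.lift fun M => (Module.finrank k (P ⟶ M) : ℤ)) <| by
    rw [exactRelations, AddSubgroup.closure_le]
    rintro _ ⟨T, hT, rfl⟩
    simp [finrank_hom_eq_add k P hT]

theorem dimHom_K0class [∀ M, Module.Finite k (P ⟶ M)] (M : C) :
    dimHom k P (K0class M) = Module.finrank k (P ⟶ M) :=
  FreeAbelianGroup.lift_apply_of _ _

theorem dimHom_K0class_eq_zero_iff [∀ M, Module.Finite k (P ⟶ M)] {M : C} :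
    dimHom k P (K0class M) = 0 ↔ Subsingleton (P ⟶ M) := by
  rw [dimHom_K0class, Nat.cast_eq_zero, Module.finrank_zero_iff]

end Grothendieck

section ClassSpan

variable {A : Type u} [Ring A] {n : ℕ} {L P : Fin n → FGModuleCat.{u} A} {π : ∀ i, P i ⟶ L i}

theorem K0class_mem_classSpan [IsArtinianRing A] (hL : IsCompleteSimpleList L)
    (hP : ∀ i, IsProjectiveCover (π i)) {S : Set (Fin n)} {M : FGModuleCat.{u} A}
    (hM : Subsingleton (coverSum P Sᶜ ⟶ M)) : K0class M ∈ classSpan L S := by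
  have := hL.simple
  have := projective_coverSum hP Sᶜ
  induction M using kernel_induction with | ind M ih
  rcases hL.isZero_or_exists_epi M with hM | ⟨i, q, _⟩
  · exact K0class_of_isZero hM ▸ zero_mem _
  · have : Subsingleton (coverSum P Sᶜ ⟶ L i) := subsingleton_hom_of_projective_of_epi q
    have hi : i ∈ S := not_not.1 ((subsingleton_coverSum_hom_simple_iff hL hP).1 this)
    rw [K0class_eq_kernel_add q]
    exact add_mem (ih q (ne_zero_of_epi q) (subsingleton_hom_of_mono (kernel.ι q)))
      (Submodule.subset_span ⟨i, hi, rfl⟩)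

theorem K0class_mem_classSpan_iff (k : Type w) [Field k] [Algebra k A] [Module.Finite k A]
    (hL : IsCompleteSimpleList L) (hP : ∀ i, IsProjectiveCover (π i)) {S : Set (Fin n)}
    {M : FGModuleCat.{u} A} : K0class M ∈ classSpan L S ↔ serre L S M := by
  have : IsArtinianRing A := .of_finite k A
  have := projective_coverSum hP Sᶜ
  have := moduleFinite_hom k (coverSum P Sᶜ)
  rw [serre_iff hL hP]
  refine ⟨fun hM => ?_, K0class_mem_classSpan hL hP⟩
  have hle : classSpan L S ≤ LinearMap.ker (dimHom k (coverSum P Sᶜ)).toIntLinearMap := by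
    refine Submodule.span_le.2 ?_
    rintro _ ⟨i, hi, rfl⟩
    exact (dimHom_K0class_eq_zero_iff k _).2
      ((subsingleton_coverSum_hom_simple_iff hL hP).2 (not_not.2 hi))
  exact (dimHom_K0class_eq_zero_iff k _).1 (hle hM)

end ClassSpan

/-! ### Modules over the quotient by a trace ideal -/

section Quotient

variable {A : Type u} [Ring A]

section Restrict

variable (I : Ideal A) [I.IsTwoSided]

instance faithful_quotientRestrict : (quotientRestrict I).Faithful where
  map_injective {M N _ _} h := FGModuleCat.hom_ext <| LinearMap.ext fun x => congr_arg
    (fun f : (quotientRestrict I).obj M ⟶ (quotientRestrict I).obj N => f.hom.hom x) h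

instance full_quotientRestrict : (quotientRestrict I).Full where
  map_surjective {M N} f := by
    let φ : (quotientRestrict I).obj M →ₗ[A] (quotientRestrict I).obj N := f.hom.hom
    exact ⟨FGModuleCat.ofHom (V := M) (W := N) { φ with
      map_smul' := Ideal.Quotient.mk_surjective.forall.2 fun a x => φ.map_smul a x }, rfl⟩

instance additive_quotientRestrict : (quotientRestrict I).Additive where

instance linear_quotientRestrict (k : Type w) [Field k] [Algebra k A] :
    (quotientRestrict I).Linear k where

theorem essImage_quotientRestrict_iff {M : FGModuleCat.{u} A} :
    (quotientRestrict I).essImage M ↔ I ≤ Module.annihilator A M := by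
  constructor
  · rintro ⟨N, ⟨e⟩⟩
    rw [← (FGModuleCat.isoToLinearEquiv e).annihilator_eq]
    intro a ha
    refine Module.mem_annihilator.2 fun x => ?_
    have : Ideal.Quotient.mk I a • (show N from x) = 0 := by
      rw [Ideal.Quotient.eq_zero_iff_mem.2 ha, zero_smul]
    exact this
  · intro h
    have ht : Module.IsTorsionBySet A M I := (Module.isTorsionBySet_iff_subset_annihilator A M).2 h
    let := ht.module
    have : IsScalarTower A (A ⧸ I) M := ht.isScalarTower
    have : Module.Finite (A ⧸ I) M := .of_restrictScalars_finite A _ _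
    let e : (quotientRestrict I).obj (FGModuleCat.of (A ⧸ I) M) ≃ₗ[A] M :=
      { AddEquiv.refl M with map_smul' := fun _ _ => rfl }
    exact ⟨FGModuleCat.of (A ⧸ I) M, ⟨e.toFGModuleCatIso⟩⟩

end Restrict

theorem subsingleton_hom_iff_traceIdeal_le {X M : FGModuleCat.{u} A} [Projective X] :
    Subsingleton (X ⟶ M) ↔ traceIdeal X ≤ Module.annihilator A M := by
  rw [← subsingleton_linearMap_iff]
  constructor
  · refine fun _ => iSup_le ?_
    rintro f _ ⟨y, rfl⟩
    exact Module.mem_annihilator.2 fun x =>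
      LinearMap.congr_fun (Subsingleton.elim (LinearMap.toSpanSingleton A M x ∘ₗ f) 0) y
  · intro h
    obtain ⟨s, hs⟩ := Module.projective_def.1 (projective_iff.1 ‹Projective X›)
    refine (subsingleton_iff_forall_eq 0).2 fun f => LinearMap.ext fun x => ?_
    rw [← hs x, Finsupp.linearCombination_apply, Finsupp.sum, map_sum]
    refine Finset.sum_eq_zero fun y _ => ?_
    rw [map_smul]
    exact Module.mem_annihilator.1
      (h (Submodule.mem_iSup_of_mem (Finsupp.lapply y ∘ₗ s) ⟨x, rfl⟩)) _

end Quotient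

/-! ### Subcategories preserved by a selfadjoint functor -/

section Preservation

variable {A : Type u} [Ring A] [IsArtinianRing A] {n : ℕ} {L P : Fin n → FGModuleCat.{u} A}
  {π : ∀ i, P i ⟶ L i} {S : Set (Fin n)}

theorem essImage_quotientRestrict_traceIdeal_iff (hL : IsCompleteSimpleList L)
    (hP : ∀ i, IsProjectiveCover (π i)) {M : FGModuleCat.{u} A} :
    (quotientRestrict (traceIdeal (coverSum P Sᶜ))).essImage M ↔ serre L S M := by
  have := projective_coverSum hP Sᶜ
  rw [essImage_quotientRestrict_iff, ← subsingleton_hom_iff_traceIdeal_le, serre_iff hL hP]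

variable {F : FGModuleCat.{u} A ⥤ FGModuleCat.{u} A}

theorem addClosure_coverSum_map (hL : IsCompleteSimpleList L) (hP : ∀ i, IsProjectiveCover (π i))
    (hF : IsSelfadjointFunctor F) (hN : ∀ M, serre L S M → serre L S (F.obj M))
    (X : FGModuleCat.{u} A) (hX : addClosure (coverSum P Sᶜ) X) :
    addClosure (coverSum P Sᶜ) (F.obj X) := by
  obtain ⟨adj⟩ := hF
  have := adj.isLeftAdjoint
  have hXproj := ((addClosure_coverSum_iff hL hP).1 hX).1
  refine (addClosure_coverSum_iff hL hP).2 ⟨adj.map_projective X hXproj, fun i hi => ?_⟩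
  have hLi : serre L S (L i) :=
    (serre_iff hL hP).2 ((subsingleton_coverSum_hom_simple_iff hL hP).2 hi)
  have := (serre_iff hL hP).1 (hN (L i) hLi)
  have : Subsingleton (X ⟶ F.obj (L i)) := hX.subsingleton_hom
  exact (adj.homEquiv X (L i)).subsingleton

theorem presentable_coverSum_map [F.PreservesZeroMorphisms] (hL : IsCompleteSimpleList L)
    (hP : ∀ i, IsProjectiveCover (π i)) (hF : IsSelfadjointFunctor F)
    (hN : ∀ M, serre L S M → serre L S (F.obj M)) (M : FGModuleCat.{u} A)
    (hM : presentable (coverSum P Sᶜ) M) : presentable (coverSum P Sᶜ) (F.obj M) := by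
  obtain ⟨adj⟩ := hF
  have := adj.leftAdjoint_preservesColimits
  have : PreservesFiniteColimits F := PreservesColimits.preservesFiniteColimits F
  have hadd := addClosure_coverSum_map hL hP ⟨adj⟩ hN
  exact presentable.map hadd M hM

end Preservation

end

end SelfadjointFunctors

open SelfadjointFunctors in
theorem mainTheorem10_general {k : Type w} [Field k]
    {A : Type u} [Ring A] [Algebra k A] [Module.Finite k A]
    {n : ℕ} (L P : Fin n → FGModuleCat.{u} A) (hL : IsCompleteSimpleList L)
    (π : ∀ i, P i ⟶ L i) (hP : ∀ i, IsProjectiveCover (π i))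
    (F : FGModuleCat.{u} A ⥤ FGModuleCat.{u} A) [F.Additive] [F.Linear k]
    (hF : IsSelfadjointFunctor F)
    (S : Set (Fin n))
    (hinv : ∀ x ∈ classSpan L S, K0map F hF.map_shortExact x ∈ classSpan L S) :
    ∃ (hN : ∀ M, serre L S M → serre L S (F.obj M))
      (hX : ∀ M, presentable (coverSum P Sᶜ) M → presentable (coverSum P Sᶜ) (F.obj M))
      (hD : ∀ M : FGModuleCat.{u} (quotientAlgebra P S),
        serre L S ((quotientRestrict (traceIdeal (coverSum P Sᶜ))).obj M))
      (_ : ((serre L S).lift (quotientRestrict (traceIdeal (coverSum P Sᶜ))) hD).IsEquivalence)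
      (_ : ((presentable (coverSum P Sᶜ)).ι ⋙ homFunctor k (coverSum P Sᶜ)).IsEquivalence),
      let Ψ : FGModuleCat.{u} (quotientAlgebra P S) ⥤ (serre L S).FullSubcategory :=
        (serre L S).lift (quotientRestrict (traceIdeal (coverSum P Sᶜ))) hD
      let Φ : (presentable (coverSum P Sᶜ)).FullSubcategory ⥤
          FGModuleCat.{u} (centralizerAlgebra P Sᶜ) :=
        (presentable (coverSum P Sᶜ)).ι ⋙ homFunctor k (coverSum P Sᶜ)
      let Fhat : FGModuleCat.{u} (quotientAlgebra P S) ⥤ FGModuleCat.{u} (quotientAlgebra P S) :=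
        Ψ ⋙ restrict (serre L S) F hN ⋙ Ψ.inv
      let Fbar : FGModuleCat.{u} (centralizerAlgebra P Sᶜ) ⥤
          FGModuleCat.{u} (centralizerAlgebra P Sᶜ) :=
        Φ.inv ⋙ restrict (presentable (coverSum P Sᶜ)) F hX ⋙ Φ
      (IsSelfadjointFunctor Fhat ∧ Fhat.Additive ∧ Fhat.Linear k) ∧
      (IsSelfadjointFunctor Fbar ∧ Fbar.Additive ∧ Fbar.Linear k) ∧
      ∀ g h : ℕ[X], Nonempty (polyFunctor g F ≅ polyFunctor h F) →
        Nonempty (polyFunctor g Fhat ≅ polyFunctor h Fhat) ∧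
        Nonempty (polyFunctor g Fbar ≅ polyFunctor h Fbar) := by
  have : IsArtinianRing A := .of_finite k A
  have := projective_coverSum hP Sᶜ
  have hN (M : FGModuleCat.{u} A) (hM : serre L S M) : serre L S (F.obj M) :=
    (K0class_mem_classSpan_iff k hL hP).1 (hinv _ ((K0class_mem_classSpan_iff k hL hP).2 hM))
  have hX := presentable_coverSum_map hL hP hF hN
  have hD (M : FGModuleCat.{u} (quotientAlgebra P S)) :=
    (essImage_quotientRestrict_traceIdeal_iff hL hP).1 (Functor.obj_mem_essImage _ M)
  have hΨ := isEquivalence_lift hD fun _ => (essImage_quotientRestrict_traceIdeal_iff hL hP).2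
  have hΦ := isEquivalence_presentable_homFunctor k (coverSum P Sᶜ)
  refine ⟨hN, hX, hD, hΨ, hΦ, ?_⟩
  intro Ψ Φ Fhat Fbar
  let eHat : Fhat ⋙ quotientRestrict _ ≅ quotientRestrict _ ⋙ F :=
    conjugateRestrictIso Ψ.asEquivalence F hN
  let eBar : Fbar ⋙ Φ.inv ⋙ (presentable _).ι ≅ (Φ.inv ⋙ (presentable _).ι) ⋙ F :=
    conjugateRestrictIso Φ.asEquivalence.symm F hX
  exact ⟨⟨.of_comp_iso hF eHat, additive_of_comp_iso eHat, linear_of_comp_iso k eHat⟩,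
    ⟨.of_comp_iso hF eBar, additive_of_comp_iso eBar, linear_of_comp_iso k eBar⟩,
    fun g h i => ⟨nonempty_polyFunctor_iso eHat i, nonempty_polyFunctor_iso eBar i⟩⟩

open SelfadjointFunctors in
theorem mainTheorem10 {k : Type w} [Field k] [IsAlgClosed k]
    {A : Type u} [Ring A] [Algebra k A] [Module.Finite k A] (hA : IsBasicAlgebra k A)
    {n : ℕ} (L P : Fin n → FGModuleCat.{u} A) (hL : IsCompleteSimpleList L)
    (π : ∀ i, P i ⟶ L i) (hP : ∀ i, IsProjectiveCover (π i))
    (F : FGModuleCat.{u} A ⥤ FGModuleCat.{u} A) [F.Additive] [F.Linear k]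
    (hF : IsSelfadjointFunctor F)
    (S : Set (Fin n)) (hS : S ⊂ Set.univ)
    (hinv : ∀ x ∈ classSpan L S, K0map F hF.map_shortExact x ∈ classSpan L S) :
    ∃ (hN : ∀ M, serre L S M → serre L S (F.obj M))
      (hX : ∀ M, presentable (coverSum P Sᶜ) M → presentable (coverSum P Sᶜ) (F.obj M))
      (hD : ∀ M : FGModuleCat.{u} (quotientAlgebra P S),
        serre L S ((quotientRestrict (traceIdeal (coverSum P Sᶜ))).obj M))
      (_ : ((serre L S).lift (quotientRestrict (traceIdeal (coverSum P Sᶜ))) hD).IsEquivalence)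
      (_ : ((presentable (coverSum P Sᶜ)).ι ⋙ homFunctor k (coverSum P Sᶜ)).IsEquivalence),
      let Ψ : FGModuleCat.{u} (quotientAlgebra P S) ⥤ (serre L S).FullSubcategory :=
        (serre L S).lift (quotientRestrict (traceIdeal (coverSum P Sᶜ))) hD
      let Φ : (presentable (coverSum P Sᶜ)).FullSubcategory ⥤
          FGModuleCat.{u} (centralizerAlgebra P Sᶜ) :=
        (presentable (coverSum P Sᶜ)).ι ⋙ homFunctor k (coverSum P Sᶜ)
      let Fhat : FGModuleCat.{u} (quotientAlgebra P S) ⥤ FGModuleCat.{u} (quotientAlgebra P S) :=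
        Ψ ⋙ restrict (serre L S) F hN ⋙ Ψ.inv
      let Fbar : FGModuleCat.{u} (centralizerAlgebra P Sᶜ) ⥤
          FGModuleCat.{u} (centralizerAlgebra P Sᶜ) :=
        Φ.inv ⋙ restrict (presentable (coverSum P Sᶜ)) F hX ⋙ Φ
      (IsSelfadjointFunctor Fhat ∧ Fhat.Additive ∧ Fhat.Linear k) ∧
      (IsSelfadjointFunctor Fbar ∧ Fbar.Additive ∧ Fbar.Linear k) ∧
      ∀ g h : ℕ[X], Nonempty (polyFunctor g F ≅ polyFunctor h F) →
        Nonempty (polyFunctor g Fhat ≅ polyFunctor h Fhat) ∧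
        Nonempty (polyFunctor g Fbar ≅ polyFunctor h Fbar) :=
  mainTheorem10_general L P hL π hP F hF S hinv
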